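/- **Theorem 3.2.** All spaces and algebras are complex. Let $\mathcal A$ be an operator algebra, that is, a norm-closed (not necessarily unital or selfadjoint) subalgebra of $B(H)$ for a Hilbert space $H$, and suppose that $\mathcal A$ has a contractive approximate identity. Let $\mathcal D$ be a C$^*$-algebra generated by $\mathcal A$: there is a completely isometric homomorphism $j:\mathcal A\to\mathcal D$ such that $j(\mathcal A)$ generates $\mathcal D$ as a C$^*$-algebra; identify $\mathcal A$ with $j(\mathcal A)$. A Banach module over a normed algebra $\mathcal B$ is a Banach space $V$ with a bilinear associative left action of $\mathcal B$ such that $\|bv\|\le\|b\|\,\|v\|$ for $b\in\mathcal B$, $v\in V$; it need not be nondegenerate. 1. Let $V$ be a Banach module over $\mathcal A$, and let $\theta:\mathcal A\to B(V)$, $\theta(a)v=av$, be the associated homomorphism. The $\mathcal A$-action on $V$ can be extended to a $\mathcal D$-action with respect to which $V$ is a Banach $\mathcal D$-module if and only if $\theta$ is the restriction to $\mathcal A$ of a contractive homomorphism $\phi:\mathcal D\to B(V)$. There is at most one such extended $\mathcal D$-action, and at most one such $\phi$. 2. (Corollary 3.3) If $V_1$ and $V_2$ are Banach $\mathcal D$-modules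 and $T:V_1\to V_2$ is an isometric surjective linear map with $T(av)=a\,T(v)$ for all $a\in\mathcal A$, $v\in V_1$, then $T(dv)=d\,T(v)$ for all $d\in\mathcal D$, $v\in V_1$. -/

import Mathlib

noncomputable section

/-- A contractive approximate identity (two-sided, norm-convergent), given as a filter: a proper
filter that contains the closed unit ball and along which `a * e → a` and `e * a → a` for every
`a`. -/
def HasContractiveApproximateIdentity (A : Type*) [NonUnitalNormedRing A] : Prop :=
  ∃ l : Filter A, l.IsApproximateUnit ∧ ∀ᶠ e in l, ‖e‖ ≤ 1

/-- The C⋆-norm of an `n × n` matrix over a C⋆-algebra `B`, i.e. the norm of `Mₙ(B)`. Mathlib's norm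
on `CStarMatrix` asks for the order of `B`; it is supplied here by the only order that makes `B` a
star-ordered ring. -/
def cstarMatrixNorm {B : Type*} [NonUnitalCStarAlgebra B] {n : ℕ}
    (M : Matrix (Fin n) (Fin n) B) : ℝ :=
  letI : PartialOrder B := CStarAlgebra.spectralOrder B
  haveI : StarOrderedRing B := CStarAlgebra.spectralOrderedRing B
  ‖CStarMatrix.ofMatrix M‖

/-- A homomorphism from an algebra `𝒜` of operators on `H` to a C⋆-algebra `D` is completely
isometric if applying it entrywise preserves the norm of all square matrices, the matrices over
`𝒜` being normed as matrices over `B(H)`. -/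
def IsCompletelyIsometric {H D : Type*} [NormedAddCommGroup H] [InnerProductSpace ℂ H]
    [CompleteSpace H] [NonUnitalCStarAlgebra D] {𝒜 : NonUnitalSubalgebra ℂ (H →L[ℂ] H)}
    (j : 𝒜 →ₙₐ[ℂ] D) : Prop :=
  ∀ (n : ℕ) (M : Matrix (Fin n) (Fin n) 𝒜),
    cstarMatrixNorm (M.map fun a => j a) = cstarMatrixNorm (M.map fun a => (a : H →L[ℂ] H))

/-- `D` is a C⋆-algebra generated by the operator algebra `𝒜`, by means of `j`: `j` is a completely
isometric homomorphism, and the ⋆-algebra generated by its range is dense in `D`. -/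
structure IsGeneratedBy {H D : Type*} [NormedAddCommGroup H] [InnerProductSpace ℂ H]
    [CompleteSpace H] [NonUnitalCStarAlgebra D] {𝒜 : NonUnitalSubalgebra ℂ (H →L[ℂ] H)}
    (j : 𝒜 →ₙₐ[ℂ] D) : Prop where
  completelyIsometric : IsCompletelyIsometric j
  dense_adjoin : Dense (NonUnitalStarAlgebra.adjoin ℂ (Set.range j) : Set D)

/-- A (left, not necessarily nondegenerate) Banach module structure on `V` over a normed algebra `A`:
an associative bilinear action with `‖a v‖ ≤ ‖a‖ ‖v‖`. -/
@[ext]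
structure BanachModule (A V : Type*) [NonUnitalNormedRing A] [Module ℂ A]
    [NormedAddCommGroup V] [NormedSpace ℂ V] where
  act : A → V → V
  add_act : ∀ a b v, act (a + b) v = act a v + act b v
  smul_act : ∀ (c : ℂ) a v, act (c • a) v = c • act a v
  act_add : ∀ a v w, act a (v + w) = act a v + act a w
  act_smul : ∀ (c : ℂ) a v, act a (c • v) = c • act a v
  mul_act : ∀ a b v, act (a * b) v = act a (act b v)
  norm_act_le : ∀ a v, ‖act a v‖ ≤ ‖a‖ * ‖v‖

/-- The homomorphism `θ : A → B(V)`, `θ a v = a v`, associated with a Banach module. -/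
def BanachModule.hom {A V : Type*} [NonUnitalNormedRing A] [Module ℂ A]
    [NormedAddCommGroup V] [NormedSpace ℂ V] (m : BanachModule A V) : A →ₙₐ[ℂ] (V →L[ℂ] V) where
  toFun a := LinearMap.mkContinuous
    { toFun := m.act a, map_add' := m.act_add a, map_smul' := fun c v => m.act_smul c a v }
    ‖a‖ (m.norm_act_le a)
  map_smul' c a := ContinuousLinearMap.ext fun v => m.smul_act c a v
  map_zero' := ContinuousLinearMap.ext fun v => by
    have h : m.act 0 v = 0 := by simpa only [zero_smul] using m.smul_act 0 0 v
    exact h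
  map_add' a b := ContinuousLinearMap.ext fun v => m.add_act a b v
  map_mul' a b := ContinuousLinearMap.ext fun v => m.mul_act a b v

/-- The action of `D` on `V` extends that of `𝒜`, where `𝒜` sits in `D` by means of `j`. -/
def BanachModule.Extends {A D V : Type*} [NonUnitalNormedRing A] [Module ℂ A]
    [NonUnitalNormedRing D] [Module ℂ D] [NormedAddCommGroup V] [NormedSpace ℂ V]
    (mD : BanachModule D V) (j : A →ₙₐ[ℂ] D) (mA : BanachModule A V) : Prop :=
  ∀ (a : A) (v : V), mD.act (j a) v = mA.act a v

/-- `φ : D → B(V)` is a contractive homomorphism whose restriction to `A`, by means of `j`, is `θ`. -/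
def IsContractiveExtension {A D V : Type*} [NonUnitalNormedRing A] [Module ℂ A]
    [NonUnitalNormedRing D] [Module ℂ D] [NormedAddCommGroup V] [NormedSpace ℂ V]
    (j : A →ₙₐ[ℂ] D) (θ : A →ₙₐ[ℂ] (V →L[ℂ] V)) (φ : D →ₙₐ[ℂ] (V →L[ℂ] V)) : Prop :=
  (∀ d : D, ‖φ d‖ ≤ ‖d‖) ∧ ∀ a : A, φ (j a) = θ a

end

/-! Banach `D`-modules and contractive homomorphisms into `B(V)` are the same data, so the substance
is uniqueness (`BanachModule.eq_of_eqOn_of_dense_adjoin`). The approximate identity `u` of `𝒜` is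
one for `D`, so selfadjoint elements of `D` act as hermitian operators on the closed subspace `W`
where `u` tends to the identity. If two actions agree at `a = h + ik`, the difference `X` of the
actions of `h` on `W` is `-i` times that for `k`. Hence `X` and `iX` are both hermitian, `exp (zX)`
is bounded in `z`, and Liouville gives `X = 0`: the actions of `star a` agree on `W`. They agree on
all of `V` because `star a * u → star a` and `u` maps `V` into `W`. Density then gives agreement on
`D`. An isometric intertwiner is handled by pulling the second module back along it. -/

open Filter Topology

/-! ### Hermitian elements of a Banach algebra, by Liouville -/

section Hermitian

variable {B : Type*} [NormedRing B] [NormedAlgebra ℂ B] [CompleteSpace B]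

/-- If `1 + t y` has norm at most `1 + O(t ^ 2)`, then `exp y` is a contraction. -/
theorem norm_exp_le_one_of_norm_one_add_smul_le {y : B} {C : ℝ}
    (h : ∀ t : ℝ, ‖1 + (t : ℂ) • y‖ ≤ 1 + C * t ^ 2) : ‖NormedSpace.exp y‖ ≤ 1 := by
  set r : ℝ → B := fun t => NormedSpace.exp ((t : ℂ) • y) - 1 - (t : ℂ) • y with hr
  have hd : HasDerivAt (fun t : ℝ => NormedSpace.exp ((t : ℂ) • y)) y 0 := by
    have h0 : HasDerivAt (fun z : ℂ => NormedSpace.exp (z • y)) y ((0 : ℝ) : ℂ) := by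
      simpa using hasDerivAt_exp_smul_const (𝕂 := ℂ) y 0
    simpa [Function.comp_def] using h0.scomp 0 Complex.ofRealCLM.hasDerivAt
  have hlo := hd.isLittleO
  refine le_of_forall_gt_imp_ge_of_dense fun c hc => ?_
  -- One `ε` absorbs the quadratic term `C * t ^ 2`, the other the remainder `r t`.
  obtain ⟨ε, hε, hεc⟩ : ∃ ε > 0, Real.exp (2 * ε) ≤ c := by
    refine ⟨Real.log c / 2, by have := Real.log_pos hc; positivity, ?_⟩
    rw [mul_div_cancel₀ _ two_ne_zero, Real.exp_log (by linarith)]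
  have h1 : ∀ᶠ t : ℝ in 𝓝 0, ‖r t‖ ≤ ε * ‖t‖ := by
    filter_upwards [hlo.def hε] with t ht
    simpa [hr] using ht
  have h2 : ∀ᶠ t : ℝ in 𝓝 0, C * t < ε := by
    have : Tendsto (fun t : ℝ => C * t) (𝓝 0) (𝓝 (C * 0)) := tendsto_id.const_mul C
    rw [mul_zero] at this
    exact this.eventually_lt_const hε
  obtain ⟨n, hn1, hn2, hn0⟩ := ((tendsto_one_div_atTop_nhds_zero_nat (𝕜 := ℝ)).eventually h1).and
    (((tendsto_one_div_atTop_nhds_zero_nat (𝕜 := ℝ)).eventually h2).and (eventually_gt_atTop 0))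
    |>.exists
  set t : ℝ := 1 / n with ht
  have hn0' : (0 : ℝ) < n := by exact_mod_cast hn0
  have htpos : 0 < t := by positivity
  have hbound : ‖NormedSpace.exp ((t : ℂ) • y)‖ ≤ Real.exp (2 * ε * t) := by
    have hsum : NormedSpace.exp ((t : ℂ) • y) = (1 + (t : ℂ) • y) + r t := by
      simp only [hr]; abel
    calc ‖NormedSpace.exp ((t : ℂ) • y)‖ ≤ (1 + C * t ^ 2) + ε * ‖t‖ := by
          rw [hsum]; exact (norm_add_le _ _).trans (add_le_add (h t) hn1)
      _ ≤ 2 * ε * t + 1 := by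
          rw [Real.norm_of_nonneg htpos.le]
          nlinarith [mul_le_mul_of_nonneg_right hn2.le htpos.le]
      _ ≤ _ := Real.add_one_le_exp _
  have hpow : NormedSpace.exp y = NormedSpace.exp ((t : ℂ) • y) ^ n := by
    let _ := NormedAlgebra.restrictScalars ℚ ℂ B
    rw [← NormedSpace.exp_nsmul, ← Nat.cast_smul_eq_nsmul ℂ, smul_smul, ht]
    have : (n : ℂ) ≠ 0 := by exact_mod_cast hn0.ne'
    push_cast
    rw [mul_one_div_cancel this, one_smul]
  calc ‖NormedSpace.exp y‖ ≤ ‖NormedSpace.exp ((t : ℂ) • y)‖ ^ n := by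
        rw [hpow]; exact norm_pow_le' _ hn0
    _ ≤ Real.exp (2 * ε * t) ^ n := by gcongr
    _ = Real.exp (2 * ε) := by
        rw [← Real.exp_nat_mul, ht]; congr 1; field_simp
    _ ≤ c := hεc

/-- An element `x` of a Banach algebra such that `x` and `i x` are both hermitian vanishes. -/
theorem eq_zero_of_norm_one_add_smul_le {x : B} {C : ℝ}
    (h : ∀ t : ℝ, ‖1 + (t : ℂ) • x‖ ≤ 1 + C * t ^ 2)
    (h' : ∀ t : ℝ, ‖1 + (t : ℂ) • (Complex.I • x)‖ ≤ 1 + C * t ^ 2) : x = 0 := by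
  have key : ∀ {y : B}, (∀ t : ℝ, ‖1 + (t : ℂ) • y‖ ≤ 1 + C * t ^ 2) → ∀ s : ℝ,
      ‖NormedSpace.exp ((s : ℂ) • y)‖ ≤ 1 := by
    intro y hy s
    refine norm_exp_le_one_of_norm_one_add_smul_le (C := C * s ^ 2) fun t => ?_
    have := hy (t * s)
    rw [smul_smul]
    push_cast at this
    exact this.trans_eq (by ring)
  have hexp : ∀ z : ℂ, ‖NormedSpace.exp (z • x)‖ ≤ 1 := by
    intro z
    have hz : z • x = (z.re : ℂ) • x + (z.im : ℂ) • (Complex.I • x) := by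
      rw [smul_smul, ← add_smul, Complex.re_add_im]
    have hcomm : Commute ((z.re : ℂ) • x) ((z.im : ℂ) • (Complex.I • x)) :=
      (((Commute.refl x).smul_right _).smul_right _).smul_left _
    let _ := NormedAlgebra.restrictScalars ℚ ℂ B
    rw [hz, NormedSpace.exp_add_of_commute hcomm]
    exact (norm_mul_le _ _).trans (mul_le_one₀ (key h _) (norm_nonneg _) (key h' _))
  have hdiff : Differentiable ℂ fun z : ℂ => NormedSpace.exp (z • x) :=
    fun z => (hasDerivAt_exp_smul_const x z).differentiableAt
  have hconst : (fun z : ℂ => NormedSpace.exp (z • x)) = fun _ => 1 := by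
    funext z
    have hb : Bornology.IsBounded (Set.range fun z : ℂ => NormedSpace.exp (z • x)) := by
      refine isBounded_iff_forall_norm_le.2 ⟨1, ?_⟩
      rintro _ ⟨z, rfl⟩
      exact hexp z
    simpa using hdiff.apply_eq_apply_of_bounded hb z 0
  -- The constant function has derivative `0` at the origin, where the derivative is also `x`.
  have hd := hasDerivAt_exp_smul_const (𝕂 := ℂ) x (0 : ℂ)
  rw [hconst] at hd
  simpa using hd.unique (hasDerivAt_const (0 : ℂ) (1 : B))

end Hermitian

/-- The points at which a net of eventually `1`-Lipschitz maps converges to the identity form a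
closed set. -/
theorem isClosed_setOf_tendsto_self {ι X : Type*} [NormedAddCommGroup X] {l : Filter ι}
    {f : ι → X → X} (hf : ∀ᶠ i in l, ∀ x y, ‖f i x - f i y‖ ≤ ‖x - y‖) :
    IsClosed {x | Tendsto (fun i => f i x) l (𝓝 x)} := by
  refine isClosed_of_closure_subset fun x hx => ?_
  refine Metric.tendsto_nhds.2 fun ε hε => ?_
  obtain ⟨y, hy, hxy⟩ := Metric.mem_closure_iff.1 hx (ε / 3) (by positivity)
  filter_upwards [hf, Metric.tendsto_nhds.1 hy (ε / 3) (by positivity)] with i hi hyi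
  calc dist (f i x) x ≤ dist (f i x) (f i y) + dist (f i y) y + dist y x := dist_triangle4 _ _ _ _
    _ < ε / 3 + ε / 3 + ε / 3 := by
        rw [dist_comm y x]
        have := hi x y
        rw [← dist_eq_norm, ← dist_eq_norm] at this
        linarith
    _ = ε := by ring

/-! ### Contractive approximate units and adjoints -/

section ApproximateUnit

variable {ι D : Type*} [NonUnitalCStarAlgebra D] {l : Filter ι} {u : ι → D}

/-- A contractive right approximate unit for `a` is a left approximate unit for `star a`. -/
theorem tendsto_mul_star_of_tendsto_mul (hu : ∀ᶠ i in l, ‖u i‖ ≤ 1) {a : D}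
    (ha : Tendsto (fun i => a * u i) l (𝓝 a)) :
    Tendsto (fun i => u i * star a) l (𝓝 (star a)) := by
  let _ : PartialOrder D := CStarAlgebra.spectralOrder D
  have : StarOrderedRing D := CStarAlgebra.spectralOrderedRing D
  have hsub : Tendsto (fun i => ‖a - a * u i‖) l (𝓝 0) := by
    simpa using ((tendsto_const_nhds (x := a)).sub ha).norm
  have hsq : ∀ᶠ i in l, ‖u i * star a - star a‖ ^ 2 ≤ 2 * (‖a - a * u i‖ * ‖a‖) := by
    filter_upwards [hu] with i hi
    set c := u i * star a - star a with hc
    set p := (a - a * u i) * star a with hp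
    -- The gap between the two sides is `a (1 - u* u) a*`, which is positive as `‖u‖ ≤ 1`.
    have hle : star c * c ≤ p + star p := by
      have h1 : a * (star (u i) * u i) * star a ≤ a * star a := by
        refine (CStarAlgebra.star_right_conjugate_le_norm_smul
          (.star_mul_self (u i))).trans ?_
        have h2 : ‖star (u i) * u i‖ ≤ 1 := by
          rw [CStarRing.norm_star_mul_self]
          exact mul_le_one₀ hi (norm_nonneg _) hi
        calc ‖star (u i) * u i‖ • (a * star a) ≤ (1 : ℝ) • (a * star a) :=
              smul_le_smul_of_nonneg_right h2 (mul_star_self_nonneg a)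
          _ = a * star a := one_smul _ _
      have h3 : p + star p - star c * c = a * star a - a * (star (u i) * u i) * star a := by
        simp only [hp, hc, star_sub, star_mul, star_star, sub_mul, mul_sub, mul_assoc]
        abel
      rw [← sub_nonneg, h3, sub_nonneg]
      exact h1
    calc ‖c‖ ^ 2 = ‖star c * c‖ := by rw [CStarRing.norm_star_mul_self, sq]
      _ ≤ ‖p + star p‖ := CStarAlgebra.norm_le_norm_of_nonneg_of_le (star_mul_self_nonneg c) hle
      _ ≤ ‖p‖ + ‖star p‖ := norm_add_le _ _
      _ = 2 * ‖p‖ := by rw [norm_star]; ring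
      _ ≤ 2 * (‖a - a * u i‖ * ‖a‖) := by
          gcongr
          simpa using norm_mul_le (a - a * u i) (star a)
  have hsq0 : Tendsto (fun i => ‖u i * star a - star a‖ ^ 2) l (𝓝 0) := by
    refine squeeze_zero' (.of_forall fun i => sq_nonneg _) hsq ?_
    simpa using (hsub.mul_const ‖a‖).const_mul 2
  rw [tendsto_iff_norm_sub_tendsto_zero]
  simpa [Real.sqrt_sq] using hsq0.sqrt

/-- A contractive left approximate unit for `a` is a right approximate unit for `star a`. -/
theorem tendsto_star_mul_of_tendsto_mul (hu : ∀ᶠ i in l, ‖u i‖ ≤ 1) {a : D}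
    (ha : Tendsto (fun i => u i * a) l (𝓝 a)) :
    Tendsto (fun i => star a * u i) l (𝓝 (star a)) := by
  have h := tendsto_mul_star_of_tendsto_mul (u := fun i => star (u i)) (a := star a) (l := l)
    (by simpa using hu) (by simpa using ha.star)
  simpa using h.star

/-- A contractive two-sided approximate unit for a set is one for the C⋆-algebra it generates. -/
theorem tendsto_mul_of_dense_adjoin {s : Set D}
    (hs : Dense (NonUnitalStarAlgebra.adjoin ℂ s : Set D)) (hu : ∀ᶠ i in l, ‖u i‖ ≤ 1)
    (hleft : ∀ a ∈ s, Tendsto (fun i => u i * a) l (𝓝 a))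
    (hright : ∀ a ∈ s, Tendsto (fun i => a * u i) l (𝓝 a)) (d : D) :
    Tendsto (fun i => u i * d) l (𝓝 d) ∧ Tendsto (fun i => d * u i) l (𝓝 d) := by
  -- Both sides are carried together because taking adjoints exchanges them.
  have hcl : IsClosed {d : D | Tendsto (fun i => u i * d) l (𝓝 d) ∧
      Tendsto (fun i => d * u i) l (𝓝 d)} := by
    refine (isClosed_setOf_tendsto_self ?_).inter (isClosed_setOf_tendsto_self ?_)
    · filter_upwards [hu] with i hi x y
      rw [← mul_sub]
      exact (norm_mul_le _ _).trans (mul_le_of_le_one_left (norm_nonneg _) hi)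
    · filter_upwards [hu] with i hi x y
      rw [← sub_mul]
      exact (norm_mul_le _ _).trans (mul_le_of_le_one_right (norm_nonneg _) hi)
  refine hcl.closure_subset_iff.2 (fun x hx => ?_) (hs d)
  induction hx using NonUnitalStarAlgebra.adjoin_induction with
  | mem x hx => exact ⟨hleft x hx, hright x hx⟩
  | add x y _ _ hx hy =>
    exact ⟨by simpa only [mul_add] using hx.1.add hy.1, by simpa only [add_mul] using hx.2.add hy.2⟩
  | zero => simp [tendsto_const_nhds]
  | mul x y _ _ hx hy =>
    exact ⟨by simpa only [mul_assoc] using hx.1.mul_const y,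
      by simpa only [mul_assoc] using hy.2.const_mul x⟩
  | smul c x _ hx =>
    exact ⟨by simpa only [mul_smul_comm] using hx.1.const_smul c,
      by simpa only [smul_mul_assoc] using hx.2.const_smul c⟩
  | star x _ hx =>
    exact ⟨tendsto_mul_star_of_tendsto_mul hu hx.2, tendsto_star_mul_of_tendsto_mul hu hx.1⟩

/-- For a selfadjoint `h` and a contraction `e`, the norm of `e + i t h e` exceeds `1` to second
order in `t` only. -/
theorem norm_add_I_smul_mul_le {h e : D} (hh : IsSelfAdjoint h) (he : ‖e‖ ≤ 1) (t : ℝ) :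
    ‖e + ((t : ℂ) * Complex.I) • (h * e)‖ ≤ 1 + t ^ 2 * ‖h‖ ^ 2 := by
  set x := e + ((t : ℂ) * Complex.I) • (h * e) with hx
  -- The terms linear in `t` cancel: `x = (1 + ith) e` with `h` selfadjoint.
  have hxx : star x * x = star e * e + ((t ^ 2 : ℝ) : ℂ) • (star (h * e) * (h * e)) := by
    have hI : (t : ℂ) * Complex.I * (t * Complex.I) = -((t ^ 2 : ℝ) : ℂ) := by
      push_cast
      linear_combination (t : ℂ) ^ 2 * Complex.I_mul_I
    have hconj : star ((t : ℂ) * Complex.I) = -((t : ℂ) * Complex.I) := by simp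
    simp only [hx, star_add, star_smul, hconj, star_mul, hh.star_eq, neg_smul, add_mul, mul_add,
      smul_mul_assoc, mul_smul_comm, neg_mul, smul_add, smul_neg, smul_smul, hI, mul_assoc, neg_neg]
    abel
  have hhe : ‖h * e‖ ≤ ‖h‖ :=
    (norm_mul_le _ _).trans (mul_le_of_le_one_right (norm_nonneg _) he)
  have hsq : ‖x‖ ^ 2 ≤ 1 + t ^ 2 * ‖h‖ ^ 2 := by
    calc ‖x‖ ^ 2 = ‖star x * x‖ := by rw [CStarRing.norm_star_mul_self, sq]
      _ ≤ ‖star e * e‖ + ‖((t ^ 2 : ℝ) : ℂ) • (star (h * e) * (h * e))‖ := by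
          rw [hxx]; exact norm_add_le _ _
      _ = ‖e‖ ^ 2 + t ^ 2 * ‖h * e‖ ^ 2 := by
          rw [norm_smul, CStarRing.norm_star_mul_self, CStarRing.norm_star_mul_self,
            Complex.norm_of_nonneg (sq_nonneg t), sq ‖e‖, sq ‖h * e‖]
      _ ≤ 1 + t ^ 2 * ‖h‖ ^ 2 := by
          gcongr
          exact pow_le_one₀ (norm_nonneg _) he
  have hnn : 0 ≤ t ^ 2 * ‖h‖ ^ 2 := by positivity
  nlinarith [norm_nonneg x]

end ApproximateUnit

/-! ### Banach modules and the essential subspace -/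

namespace BanachModule

variable {A V : Type*} [NonUnitalNormedRing A] [Module ℂ A]
  [NormedAddCommGroup V] [NormedSpace ℂ V]

@[simp]
theorem hom_apply (m : BanachModule A V) (a : A) (v : V) : m.hom a v = m.act a v := rfl

theorem norm_hom_le (m : BanachModule A V) (a : A) : ‖m.hom a‖ ≤ ‖a‖ :=
  LinearMap.mkContinuous_norm_le _ (norm_nonneg a) (m.norm_act_le a)

/-- The Banach module associated with a contractive homomorphism into `B(V)`. -/
def ofHom (φ : A →ₙₐ[ℂ] (V →L[ℂ] V)) (hφ : ∀ a, ‖φ a‖ ≤ ‖a‖) : BanachModule A V where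
  act a v := φ a v
  add_act a b v := by simp
  smul_act c a v := by simp
  act_add a v w := by simp
  act_smul c a v := by simp
  mul_act a b v := by simp
  norm_act_le a v := (φ a).le_of_opNorm_le (hφ a) v

/-- Transport of a Banach module along an isometric isomorphism. -/
def comap {V' : Type*} [NormedAddCommGroup V'] [NormedSpace ℂ V'] (m : BanachModule A V')
    (T : V ≃ₗᵢ[ℂ] V') : BanachModule A V where
  act a v := T.symm (m.act a (T v))
  add_act a b v := by simp [m.add_act]
  smul_act c a v := by simp [m.smul_act]
  act_add a v w := by simp [m.act_add]
  act_smul c a v := by simp [m.act_smul]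
  mul_act a b v := by simp [m.mul_act]
  norm_act_le a v := by simpa using m.norm_act_le a (T v)

theorem act_sub (m : BanachModule A V) (a : A) (v w : V) :
    m.act a (v - w) = m.act a v - m.act a w := map_sub (m.hom a) v w

theorem continuous_act (m : BanachModule A V) (a : A) : Continuous (m.act a) :=
  (m.hom a).continuous

theorem tendsto_act {ι : Type*} {l : Filter ι} {f : ι → A} {a : A} (m : BanachModule A V)
    (hf : Tendsto f l (𝓝 a)) (v : V) : Tendsto (fun i => m.act (f i) v) l (𝓝 (m.act a v)) := by
  have h : Continuous fun a => m.act a v :=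
    AddMonoidHomClass.continuous_of_bound
      ({ toFun := fun a => m.act a v, map_zero' := by simp [← hom_apply],
         map_add' := fun a b => m.add_act a b v } : A →+ V) ‖v‖
      fun a => (m.norm_act_le a v).trans_eq (mul_comm _ _)
  exact (h.tendsto a).comp hf

/-- The subspace of the vectors on which a net `u` of contractions acts asymptotically as the
identity. -/
def essential {ι : Type*} (m : BanachModule A V) (u : ι → A) (l : Filter ι) : Submodule ℂ V where
  carrier := {v | Tendsto (fun i => m.act (u i) v) l (𝓝 v)}
  add_mem' {v w} hv hw := by
    simpa only [Set.mem_ofPred_eq, m.act_add] using Tendsto.add hv hw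
  zero_mem' := by simp [← hom_apply, tendsto_const_nhds]
  smul_mem' c v hv := by
    simpa only [Set.mem_ofPred_eq, m.act_smul] using Tendsto.const_smul hv c

theorem mem_essential {ι : Type*} {m : BanachModule A V} {u : ι → A} {l : Filter ι} {v : V} :
    v ∈ m.essential u l ↔ Tendsto (fun i => m.act (u i) v) l (𝓝 v) := Iff.rfl

theorem isClosed_essential {ι : Type*} (m : BanachModule A V) {u : ι → A} {l : Filter ι}
    (hu : ∀ᶠ i in l, ‖u i‖ ≤ 1) : IsClosed (m.essential u l : Set V) := by
  refine isClosed_setOf_tendsto_self ?_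
  filter_upwards [hu] with i hi x y
  rw [← act_sub]
  exact (m.norm_act_le _ _).trans (mul_le_of_le_one_left (norm_nonneg _) hi)

/-- This lets differences of actions restrict to operators on the essential subspace. -/
theorem act_mem_essential {ι : Type*} (m : BanachModule A V) {u : ι → A} {l : Filter ι} {a : A}
    (ha : Tendsto (fun i => u i * a) l (𝓝 a)) (v : V) : m.act a v ∈ m.essential u l := by
  simpa only [mem_essential, m.mul_act] using m.tendsto_act ha v

end BanachModule

/-! ### Uniqueness of the extended action -/

section Uniqueness

variable {ι D V : Type*} [NonUnitalCStarAlgebra D] [NormedAddCommGroup V] [NormedSpace ℂ V]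
  {l : Filter ι} {u : ι → D}

/-- A selfadjoint element acts as a hermitian operator on the essential subspace. -/
theorem BanachModule.norm_add_act_le [l.NeBot] (m : BanachModule D V) (hu : ∀ᶠ i in l, ‖u i‖ ≤ 1)
    {h : D} (hh : IsSelfAdjoint h) {w : V} (hw : w ∈ m.essential u l) (t : ℝ) :
    ‖w + ((t : ℂ) * Complex.I) • m.act h w‖ ≤ (1 + t ^ 2 * ‖h‖ ^ 2) * ‖w‖ := by
  -- The net `u` stands in for a unit of `D`, which need not exist.
  have hlim : Tendsto (fun i => m.act (u i + ((t : ℂ) * Complex.I) • (h * u i)) w) l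
      (𝓝 (w + ((t : ℂ) * Complex.I) • m.act h w)) := by
    simp only [m.add_act, m.smul_act, m.mul_act]
    exact Tendsto.add hw ((((m.continuous_act h).tendsto w).comp hw).const_smul _)
  refine le_of_tendsto hlim.norm ?_
  filter_upwards [hu] with i hi
  exact (m.norm_act_le _ _).trans
    (mul_le_mul_of_nonneg_right (norm_add_I_smul_mul_le hh hi t) (norm_nonneg w))

/-- The difference of two hermitian operators is hermitian. -/
theorem BanachModule.norm_add_act_sub_act_le [l.NeBot] (m₁ m₂ : BanachModule D V)
    (hu : ∀ᶠ i in l, ‖u i‖ ≤ 1) {h : D} (hh : IsSelfAdjoint h) {w : V}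
    (hw₁ : w ∈ m₁.essential u l) (hw₂ : w ∈ m₂.essential u l) (t : ℝ) :
    ‖w + ((t : ℂ) * Complex.I) • (m₁.act h w - m₂.act h w)‖ ≤
      (1 + 4 * ‖h‖ ^ 2 * t ^ 2) * ‖w‖ := by
  -- The target is the average of `(1 + 2ith)w` and `(1 - 2ith)w`, one for each action; the doubling
  -- yields the factor 4.
  have h₁ := m₁.norm_add_act_le hu hh hw₁ (2 * t)
  have h₂ := m₂.norm_add_act_le hu hh hw₂ (-(2 * t))
  set x₁ := w + (((2 * t : ℝ) : ℂ) * Complex.I) • m₁.act h w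
  set x₂ := w + (((-(2 * t) : ℝ) : ℂ) * Complex.I) • m₂.act h w
  have hsum : w + ((t : ℂ) * Complex.I) • (m₁.act h w - m₂.act h w) =
      (1 / 2 : ℂ) • (x₁ + x₂) := by
    simp only [x₁, x₂]
    push_cast
    module
  have hn : ‖(1 / 2 : ℂ)‖ = 1 / 2 := by norm_num
  rw [hsum, norm_smul, hn]
  have := norm_add_le x₁ x₂
  nlinarith

/-- If two Banach module structures over a C⋆-algebra agree at `a`, then they agree at `star a` on
the essential subspace. -/
theorem BanachModule.act_star_eq_of_mem_essential [CompleteSpace V] [l.NeBot]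
    {m₁ m₂ : BanachModule D V} (hu : ∀ᶠ i in l, ‖u i‖ ≤ 1)
    (hul : ∀ d, Tendsto (fun i => u i * d) l (𝓝 d))
    (hess : m₁.essential u l = m₂.essential u l) {a : D} (ha : ∀ v, m₁.act a v = m₂.act a v)
    {w : V} (hw : w ∈ m₁.essential u l) : m₁.act (star a) w = m₂.act (star a) w := by
  set W := m₁.essential u l
  have : CompleteSpace W := (m₁.isClosed_essential hu).completeSpace_coe
  set h : D := (realPart a : D)
  set k : D := (imaginaryPart a : D)
  have hh : IsSelfAdjoint h := (realPart a).2
  have hk : IsSelfAdjoint k := (imaginaryPart a).2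
  have hak : a = h + Complex.I • k := (realPart_add_I_smul_imaginaryPart a).symm
  have hastar : star a = h - Complex.I • k := by
    rw [hak, star_add, star_smul, hh.star_eq, hk.star_eq, RCLike.star_def, Complex.conj_I, neg_smul,
      sub_eq_add_neg]
  let X : W →L[ℂ] W := ((m₁.hom h - m₂.hom h).comp W.subtypeL).codRestrict W fun w =>
    W.sub_mem (m₁.act_mem_essential (hul h) _) (hess.ge (m₂.act_mem_essential (hul h) _))
  have hXh : ∀ w : W, (X w : V) = m₁.act h w - m₂.act h w := fun _ => rfl
  -- Agreement at `a = h + ik` turns the difference for `h` into `-i` times that for `k`.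
  have hXk : ∀ w : W, (X w : V) = -Complex.I • (m₁.act k w - m₂.act k w) := by
    intro w
    have := ha w
    rw [hak, m₁.add_act, m₂.add_act, m₁.smul_act, m₂.smul_act] at this
    rw [hXh, neg_smul, smul_sub, neg_sub, sub_eq_sub_iff_add_eq_add, this, add_comm]
  have hmem₂ : ∀ w : W, (w : V) ∈ m₂.essential u l := fun w => hess.le w.2
  have hX : X = 0 := by
    refine eq_zero_of_norm_one_add_smul_le (B := W →L[ℂ] W) (x := X)
      (C := 4 * ‖h‖ ^ 2 + 4 * ‖k‖ ^ 2) (fun t => ?_)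
      fun t => ?_
    · refine ContinuousLinearMap.opNorm_le_bound _ (by positivity) fun w => ?_
      have := m₁.norm_add_act_sub_act_le m₂ hu hk w.2 (hmem₂ w) (-t)
      have heq : (((1 + (t : ℂ) • X) w : W) : V) =
          w + (((-t : ℝ) : ℂ) * Complex.I) • (m₁.act k w - m₂.act k w) := by
        simp only [add_apply, one_apply_eq_self,
          smul_apply, Submodule.coe_add, Submodule.coe_smul, hXk]
        push_cast
        module
      rw [Submodule.coe_norm, heq]
      refine this.trans ?_
      gcongr ?_ * _
      nlinarith [mul_nonneg (sq_nonneg ‖h‖) (sq_nonneg t)]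
    · refine ContinuousLinearMap.opNorm_le_bound _ (by positivity) fun w => ?_
      have := m₁.norm_add_act_sub_act_le m₂ hu hh w.2 (hmem₂ w) t
      have heq : (((1 + (t : ℂ) • (Complex.I • X)) w : W) : V) =
          w + ((t : ℂ) * Complex.I) • (m₁.act h w - m₂.act h w) := by
        simp only [add_apply, one_apply_eq_self,
          smul_apply, Submodule.coe_add, Submodule.coe_smul, hXh, smul_smul]
      rw [Submodule.coe_norm, heq]
      refine this.trans ?_
      gcongr ?_ * _
      nlinarith [mul_nonneg (sq_nonneg ‖k‖) (sq_nonneg t)]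
  have hX0 : (X ⟨w, hw⟩ : V) = 0 := by rw [hX]; rfl
  have hheq : m₁.act h w = m₂.act h w := sub_eq_zero.1 ((hXh ⟨w, hw⟩).symm.trans hX0)
  have hIk : m₁.act (Complex.I • k) w = m₂.act (Complex.I • k) w := by
    have := ha w
    rw [hak, m₁.add_act, m₂.add_act, hheq] at this
    exact add_left_cancel this
  have hsub : ∀ m : BanachModule D V, m.act (h - Complex.I • k) w =
      m.act h w - m.act (Complex.I • k) w := fun m => by
    simp only [← hom_apply, map_sub, sub_apply]
  rw [hastar, hsub, hsub, hheq, hIk]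

/-- Two Banach module structures over a C⋆-algebra `D` agree if they agree on a set that generates
`D` and contains a contractive approximate unit for itself. -/
theorem BanachModule.eq_of_eqOn_of_dense_adjoin [CompleteSpace V] [l.NeBot] {s : Set D}
    (hs : Dense (NonUnitalStarAlgebra.adjoin ℂ s : Set D)) (hus : ∀ i, u i ∈ s)
    (hu : ∀ᶠ i in l, ‖u i‖ ≤ 1) (hleft : ∀ a ∈ s, Tendsto (fun i => u i * a) l (𝓝 a))
    (hright : ∀ a ∈ s, Tendsto (fun i => a * u i) l (𝓝 a)) {m₁ m₂ : BanachModule D V}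
    (h : ∀ a ∈ s, ∀ v, m₁.act a v = m₂.act a v) : m₁ = m₂ := by
  have hul := fun d => (tendsto_mul_of_dense_adjoin hs hu hleft hright d).1
  have hur := fun d => (tendsto_mul_of_dense_adjoin hs hu hleft hright d).2
  have hess : m₁.essential u l = m₂.essential u l := by
    ext v
    simp only [mem_essential, h _ (hus _)]
  have hstar : ∀ a ∈ s, ∀ v, m₁.act (star a) v = m₂.act (star a) v := by
    intro a ha v
    -- Inserting `u i` replaces `v` by a vector of the essential subspace, the same for both actions
    -- since `u i ∈ s`.
    refine tendsto_nhds_unique (m₁.tendsto_act (hur (star a)) v) ?_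
    refine (m₂.tendsto_act (hur (star a)) v).congr fun i => ?_
    rw [m₁.mul_act, m₂.mul_act, ← h _ (hus i)]
    exact (act_star_eq_of_mem_essential hu hul hess (h a ha)
      (m₁.act_mem_essential (hul _) v)).symm
  have hall : ∀ d ∈ NonUnitalStarAlgebra.adjoin ℂ s, ∀ v, m₁.act d v = m₂.act d v := by
    intro d hd
    -- As an algebra this is generated by `s ∪ star s`, so the induction has no star case.
    rw [← NonUnitalStarSubalgebra.mem_toNonUnitalSubalgebra,
      NonUnitalStarAlgebra.adjoin_toNonUnitalSubalgebra] at hd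
    induction hd using NonUnitalAlgebra.adjoin_induction with
    | mem x hx =>
      rcases hx with hx | hx
      · exact h x hx
      · simpa using hstar _ hx
    | add x y _ _ hx hy => intro v; rw [m₁.add_act, m₂.add_act, hx, hy]
    | zero => intro v; simp [← hom_apply]
    | mul x y _ _ hx hy => intro v; rw [m₁.mul_act, m₂.mul_act, hy, hx]
    | smul c x _ hx => intro v; rw [m₁.smul_act, m₂.smul_act, hx]
  ext d v
  refine congrFun (Continuous.ext_on hs (f := fun d => m₁.act d v) (g := fun d => m₂.act d v)
    ?_ ?_ fun d hd => hall d hd v) d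
  · exact continuous_iff_continuousAt.2 fun d => m₁.tendsto_act tendsto_id v
  · exact continuous_iff_continuousAt.2 fun d => m₂.tendsto_act tendsto_id v

end Uniqueness

/-! ### Entrywise bounds for the matrix norm -/

section MatrixNorm

variable {B : Type*} [NonUnitalCStarAlgebra B]

theorem norm_le_cstarMatrixNorm {n : ℕ} (M : Matrix (Fin n) (Fin n) B) (i k : Fin n) :
    ‖M i k‖ ≤ cstarMatrixNorm M := by
  let _ : PartialOrder B := CStarAlgebra.spectralOrder B
  have : StarOrderedRing B := CStarAlgebra.spectralOrderedRing B
  exact CStarMatrix.norm_entry_le_norm (M := CStarMatrix.ofMatrix M)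

/-- A crude bound, but sharp for `1 × 1` matrices, where it is applied. -/
theorem CStarMatrix.norm_le_sum [PartialOrder B] [StarOrderedRing B] {m n : Type*} [Fintype m]
    [Fintype n] (M : CStarMatrix m n B) : ‖M‖ ≤ ∑ k, ∑ i, ‖M i k‖ := by
  rw [CStarMatrix.norm_def]
  refine (CStarMatrix.toCLM M).opNorm_le_bound (by positivity) fun v => ?_
  simp only [CStarMatrix.toCLM_apply_eq_sum, Finset.sum_mul]
  apply WithCStarModule.pi_norm_le_sum_norm _ |>.trans
  gcongr with i _
  apply norm_sum_le _ _ |>.trans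
  gcongr with k _
  apply norm_mul_le _ _ |>.trans
  rw [mul_comm]
  gcongr
  exact WithCStarModule.norm_apply_le_norm v k

theorem cstarMatrixNorm_le_sum {n : ℕ} (M : Matrix (Fin n) (Fin n) B) :
    cstarMatrixNorm M ≤ ∑ k, ∑ i, ‖M i k‖ :=
  let _ : PartialOrder B := CStarAlgebra.spectralOrder B
  have : StarOrderedRing B := CStarAlgebra.spectralOrderedRing B
  CStarMatrix.norm_le_sum (CStarMatrix.ofMatrix M)

end MatrixNorm

/-! ### Application to a generating operator algebra -/

section Generated

variable {H D : Type*} [NormedAddCommGroup H] [InnerProductSpace ℂ H] [CompleteSpace H]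
  [NonUnitalCStarAlgebra D] {𝒜 : NonUnitalSubalgebra ℂ (H →L[ℂ] H)} {j : 𝒜 →ₙₐ[ℂ] D}

theorem IsCompletelyIsometric.norm_apply_le (hj : IsCompletelyIsometric j) (a : 𝒜) :
    ‖j a‖ ≤ ‖a‖ := by
  have h := hj 1 fun _ _ => a
  calc ‖j a‖ ≤ cstarMatrixNorm (Matrix.map (fun _ _ : Fin 1 => a) fun a => j a) :=
        norm_le_cstarMatrixNorm (Matrix.map (fun _ _ : Fin 1 => a) fun a => j a) 0 0
    _ = _ := h
    _ ≤ _ := cstarMatrixNorm_le_sum _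
    _ = ‖a‖ := by simp only [Fin.sum_univ_one]; rfl

/-- Two Banach module structures over a C⋆-algebra generated by an operator algebra with a
contractive approximate identity agree if they agree on that operator algebra. -/
theorem IsGeneratedBy.banachModule_ext (hj : IsGeneratedBy j)
    (hA : HasContractiveApproximateIdentity 𝒜) {V : Type*} [NormedAddCommGroup V]
    [NormedSpace ℂ V] [CompleteSpace V] {m₁ m₂ : BanachModule D V}
    (h : ∀ a v, m₁.act (j a) v = m₂.act (j a) v) : m₁ = m₂ := by
  obtain ⟨l, hl, hl1⟩ := hA
  have := hl.neBot
  have hcont : Continuous j := AddMonoidHomClass.continuous_of_bound j 1 fun a => by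
    simpa using hj.completelyIsometric.norm_apply_le a
  refine BanachModule.eq_of_eqOn_of_dense_adjoin (l := l) (u := j) hj.dense_adjoin
    (fun i => ⟨i, rfl⟩) ?_ ?_ ?_ ?_
  · filter_upwards [hl1] with e he
    exact (hj.completelyIsometric.norm_apply_le e).trans he
  · rintro _ ⟨a, rfl⟩
    simpa [Function.comp_def] using (hcont.tendsto a).comp (hl.tendsto_mul_right a)
  · rintro _ ⟨a, rfl⟩
    simpa [Function.comp_def] using (hcont.tendsto a).comp (hl.tendsto_mul_left a)
  · rintro _ ⟨a, rfl⟩ v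
    exact h a v

end Generated

theorem theorem3p2
    {H : Type*} [NormedAddCommGroup H] [InnerProductSpace ℂ H] [CompleteSpace H]
    (𝒜 : NonUnitalSubalgebra ℂ (H →L[ℂ] H)) (h_closed : IsClosed (𝒜 : Set (H →L[ℂ] H)))
    (h_cai : HasContractiveApproximateIdentity 𝒜)
    {D : Type*} [NonUnitalCStarAlgebra D] (j : 𝒜 →ₙₐ[ℂ] D) (hj : IsGeneratedBy j) :
    (∀ (V : Type*) [NormedAddCommGroup V] [NormedSpace ℂ V] [CompleteSpace V]
        (m : BanachModule 𝒜 V),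
      ((∃ δ : BanachModule D V, δ.Extends j m) ↔
        ∃ φ : D →ₙₐ[ℂ] (V →L[ℂ] V), IsContractiveExtension j m.hom φ) ∧
      (∀ δ₁ δ₂ : BanachModule D V, δ₁.Extends j m → δ₂.Extends j m → δ₁ = δ₂) ∧
      (∀ φ₁ φ₂ : D →ₙₐ[ℂ] (V →L[ℂ] V), IsContractiveExtension j m.hom φ₁ →
        IsContractiveExtension j m.hom φ₂ → φ₁ = φ₂)) ∧
    (∀ (V₁ V₂ : Type*) [NormedAddCommGroup V₁] [NormedSpace ℂ V₁] [CompleteSpace V₁]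
        [NormedAddCommGroup V₂] [NormedSpace ℂ V₂] [CompleteSpace V₂]
        (m₁ : BanachModule D V₁) (m₂ : BanachModule D V₂) (T : V₁ →ₗ[ℂ] V₂),
      Isometry T → Function.Surjective T →
      (∀ (a : 𝒜) (v : V₁), T (m₁.act (j a) v) = m₂.act (j a) (T v)) →
      ∀ (d : D) (v : V₁), T (m₁.act d v) = m₂.act d (T v)) := by
  refine ⟨fun V _ _ _ m => ⟨⟨?_, ?_⟩, ?_, ?_⟩, ?_⟩
  · rintro ⟨δ, hδ⟩
    exact ⟨δ.hom, δ.norm_hom_le, fun a => ContinuousLinearMap.ext fun v => hδ a v⟩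
  · rintro ⟨φ, hφ, hφθ⟩
    exact ⟨.ofHom φ hφ, fun a v => congrArg (· v) (hφθ a)⟩
  · intro δ₁ δ₂ h₁ h₂
    exact hj.banachModule_ext h_cai fun a v => (h₁ a v).trans (h₂ a v).symm
  · rintro φ₁ φ₂ ⟨h₁, h₁θ⟩ ⟨h₂, h₂θ⟩
    have h : BanachModule.ofHom φ₁ h₁ = .ofHom φ₂ h₂ :=
      hj.banachModule_ext h_cai fun a v => congrArg (· v) ((h₁θ a).trans (h₂θ a).symm)
    ext d v
    exact congrFun (congrFun (congrArg BanachModule.act h) d) v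
  · intro V₁ V₂ _ _ _ _ _ _ m₁ m₂ T hT hsurj hTA d v
    let e : V₁ ≃ₗᵢ[ℂ] V₂ := LinearIsometryEquiv.ofSurjective
      ⟨T, fun v => (AddMonoidHomClass.isometry_iff_norm T).1 hT v⟩ hsurj
    have he : ∀ v, e v = T v := fun _ => rfl
    -- Intertwining over `𝒜` says exactly that these two structures on `V₁` agree on `j(𝒜)`.
    have h : m₁ = m₂.comap e := hj.banachModule_ext h_cai fun a v =>
      e.injective ((hTA a v).trans (e.apply_symm_apply _).symm)
    rw [← he, h]
    exact e.apply_symm_apply _
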